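/- For $x \in \mathbb R$ let $\|x\|$ be the distance from $x$ to the nearest integer, and let $\varphi$ be Euler's totient function. Let $\alpha$ be an irrational real number that is not Liouville. Let \[ \mu(\alpha) = \sup\{ w > 0 : \|n\alpha\| < n^{-w} \text{ for infinitely many } n \in \mathbb N\} \] be its diophantine exponent, and put $\lambda = 1 + \mu(\alpha)$ and $\varepsilon = \frac{1}{10\lambda}$. For $\gamma \in \mathbb R$ let \[ B = \{ n \in \mathbb N : \|n\alpha - \gamma\| < n^{-4\varepsilon} \} \] and, for $N \in \mathbb N$, \[ T_N(\alpha,\gamma) = \sum_{\substack{1 \le n \le N \\ n \notin B}} \frac{1}{\|n\alpha-\gamma\|}, \qquad T_N^*(\alpha,\gamma) = \sum_{\substack{1 \le n \le N \\ n \notin B}} \frac{\varphi(n)}{n\|n\alpha-\gamma\|}. \] Then there are constants $c, C > 0$ and $N_0 \in \mathbb N$, depending only on $\alpha$, such that for every $\gamma \in \mathbb R$ and every integer $N \ge N_0$, \[ c N\log N \le T_N(\alpha,\gamma) \le C N \log N, \qquad c N\log N \le T_N^*(\alpha,\gamma) \le C N \log N, \] and $c\, T_N^*(\alpha,\gamma)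 \le T_N(\alpha,\gamma) \le C\, T_N^*(\alpha,\gamma)$; that is, $T_N(\alpha,\gamma) \asymp T_N^*(\alpha,\gamma) \asymp N \log N$. In particular $T_N(\alpha,\gamma) \ll N\log N$ and $T^*_N(\alpha,\gamma) \gg N\log N$. -/

import Mathlib

noncomputable section

namespace FracSums

/-- The distance `‖x‖` from a real number `x` to the nearest integer. -/
def distInt (x : ℝ) : ℝ := |x - round x|

/-- The exponents `w > 0` for which `‖n α‖ < n ^ (-w)` for infinitely many positive integers `n`. -/
def exponentSet (α : ℝ) : Set ℝ :=
  {w : ℝ | 0 < w ∧ {n : ℕ | 1 ≤ n ∧ distInt (n * α) < (n : ℝ) ^ (-w)}.Infinite}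

/-- The diophantine exponent `μ(α)`. For `α` irrational and not Liouville the set is nonempty
(it contains `1`, by Dirichlet's theorem) and bounded above, so this is its true supremum. -/
def diophExponent (α : ℝ) : ℝ := sSup (exponentSet α)

/-- `ε = 1 / (10 λ)` with `λ = 1 + μ(α)`. -/
def eps (α : ℝ) : ℝ := 1 / (10 * (1 + diophExponent α))

/-- The set `B` of positive integers `n` with `‖n α - γ‖ < n ^ (-4 ε)`. -/
def badSet (α γ : ℝ) : Set ℕ :=
  {n : ℕ | 1 ≤ n ∧ distInt (n * α - γ) < (n : ℝ) ^ (-(4 * eps α))}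

open Classical in
/-- `T_N(α, γ)`: the sum of `1 / ‖n α - γ‖` over `1 ≤ n ≤ N` with `n ∉ B`. -/
def T (α γ : ℝ) (N : ℕ) : ℝ :=
  ∑ n ∈ (Finset.Icc 1 N).filter (fun n => n ∉ badSet α γ), 1 / distInt (n * α - γ)

open Classical in
/-- `T*_N(α, γ)`: the sum of `φ(n) / (n ‖n α - γ‖)` over `1 ≤ n ≤ N` with `n ∉ B`. -/
def TStar (α γ : ℝ) (N : ℕ) : ℝ :=
  ∑ n ∈ (Finset.Icc 1 N).filter (fun n => n ∉ badSet α γ),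
    (Nat.totient n : ℝ) / (n * distInt (n * α - γ))

end FracSums

end

namespace FracSums

/-! Both sums are estimated dyadically: `1 / x` is comparable to the sum of `2 ^ k` over the scales
with `x ≤ 2 ^ (-k)`. It therefore suffices that about `δ N` of the `n ≤ N` satisfy `‖n α - γ‖ ≤ δ`,
uniformly in `γ`. Each scale then contributes about `N`, and about `log N` scales occur, since off
`B` no distance is below `N ^ (-4 ε)`.

The counts come from a Dirichlet approximation `p / q`: over `q` consecutive `n`, the points `n α -
γ` mod 1 lie within `2 / q` of a permutation of the fractions with denominator `q`. As `α` is not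
Liouville, `q` is at least a constant times `N ^ (8 ε)`, so the error is negligible for `δ ≥ N ^ (-4
ε)`. The same holds for `d α` with `d ≤ N ^ ε` (`exists_large_denominator`, `exists_card_hits_le`).

For the totient weight, only the lower bound needs work. Since `φ(n) / n ≥ exp (-2 ∑ 1 / p)` over
primes `p ∣ n`, it is enough that `∑ 1 / p` is bounded on average over the hits outside `B`.
Interchanging sums reduces this to counting hits divisible by `d`, that is, hits for `d α` up to `N
/ d`, and to the convergence of `∑ 1 / d ^ 2`. Convexity of `exp` then gives the average of `φ(n) /
n` (`exp_mul_card_le_sum_totient`). -/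

theorem distInt_nonneg (x : ℝ) : 0 ≤ distInt x := abs_nonneg _

theorem distInt_le_abs_sub (x : ℝ) (m : ℤ) : distInt x ≤ |x - m| := round_le x m

theorem distInt_le_half (x : ℝ) : distInt x ≤ 1 / 2 := abs_sub_round x

/-! ### Hits in one block of length `q`. -/

/-- In a block of `q` consecutive integers, the `n` with `‖n β - γ‖ ≤ δ`. -/
noncomputable def blockHits (β γ δ : ℝ) (q a : ℕ) : Finset ℕ :=
  (Finset.range q).filter fun j => distInt (((a + j : ℕ) : ℝ) * β - γ) ≤ δ

/-- Replacing `q β` by `p` costs at most `j / q ≤ 1`, and the floor costs less than 1. So, up to `2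
/ q`, the block behaves like the progression `(s + j p) / q` mod 1. -/
theorem abs_block_sub_le {β γ : ℝ} {p : ℤ} {q : ℕ} (hq : 0 < q)
    (hβ : |q * β - p| ≤ 1 / q) (a j : ℕ) (hj : j < q) :
    |q * (((a + j : ℕ) : ℝ) * β - γ) - ((⌊(q : ℝ) * (a * β - γ)⌋ + j * p : ℤ) : ℝ)| ≤ 2 := by
  have hq' : (0 : ℝ) < q := by exact_mod_cast hq
  have hj' : (j : ℝ) ≤ q := by exact_mod_cast hj.le
  have h1 : |(j : ℝ) * (q * β - p)| ≤ 1 := by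
    rw [abs_mul, Nat.abs_cast]
    calc (j : ℝ) * |q * β - p| ≤ q * (1 / q) := by gcongr
      _ = 1 := by field_simp
  have h2 := Int.floor_le ((q : ℝ) * (a * β - γ))
  have h3 := Int.lt_floor_add_one ((q : ℝ) * (a * β - γ))
  rw [abs_le] at h1 ⊢
  push_cast
  constructor <;> nlinarith

/-- A hit forces `s + j p` to be congruent mod `q` to an integer `f j` of absolute value at most `δ
q + 2`. As `p` is invertible mod `q`, distinct `j` give distinct `f j`. -/
theorem card_blockHits_le {β γ δ : ℝ} {p : ℤ} {q : ℕ} (hq : 0 < q) (hpq : IsCoprime p (q : ℤ))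
    (hβ : |q * β - p| ≤ 1 / q) (hδ : 0 ≤ δ) (a : ℕ) :
    ((blockHits β γ δ q a).card : ℝ) ≤ 2 * δ * q + 5 := by
  have hq' : (0 : ℝ) < q := by exact_mod_cast hq
  set s : ℤ := ⌊(q : ℝ) * (a * β - γ)⌋ with hs
  set R : ℤ := ⌊δ * q + 2⌋ with hR
  have hR0 : 0 ≤ R := Int.floor_nonneg.2 (by positivity)
  let f : ℕ → ℤ := fun j => s + j * p - q * round (((a + j : ℕ) : ℝ) * β - γ)
  have hmaps : ∀ j ∈ blockHits β γ δ q a, f j ∈ Finset.Icc (-R) R := by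
    intro j hj
    obtain ⟨hjq, hjd⟩ := Finset.mem_filter.1 hj
    have h1 := abs_block_sub_le (γ := γ) hq hβ a j (Finset.mem_range.1 hjq)
    rw [← hs] at h1
    have h2 : |q * (((a + j : ℕ) : ℝ) * β - γ) - q * (round (((a + j : ℕ) : ℝ) * β - γ) : ℝ)|
        ≤ δ * q := by
      rw [← mul_sub, abs_mul, Nat.abs_cast, mul_comm]
      exact mul_le_mul_of_nonneg_right hjd hq'.le
    have h3 : |(f j : ℝ)| ≤ δ * q + 2 := by
      simp only [f]
      rw [abs_le] at h1 h2 ⊢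
      push_cast at h1 h2 ⊢
      constructor <;> linarith
    rw [Finset.mem_Icc, ← abs_le, hR, Int.le_floor]
    simpa using h3
  have hinj : Set.InjOn f (blockHits β γ δ q a) := by
    intro i hi j hj hij
    have hi' := Finset.mem_range.1 (Finset.mem_filter.1 (Finset.mem_coe.1 hi)).1
    have hj' := Finset.mem_range.1 (Finset.mem_filter.1 (Finset.mem_coe.1 hj)).1
    have hdvd : (q : ℤ) ∣ ((i : ℤ) - j) * p :=
      ⟨round (((a + i : ℕ) : ℝ) * β - γ) - round (((a + j : ℕ) : ℝ) * β - γ), by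
        simp only [f] at hij; linarith⟩
    have h := hpq.symm.dvd_of_dvd_mul_right hdvd
    have h0 := Int.eq_zero_of_abs_lt_dvd h (by rw [abs_lt]; omega)
    omega
  have hcard := Finset.card_le_card_of_injOn f hmaps hinj
  rw [Int.card_Icc] at hcard
  have h4 : ((blockHits β γ δ q a).card : ℤ) ≤ 2 * R + 1 := by omega
  have h5 : ((blockHits β γ δ q a).card : ℝ) ≤ 2 * R + 1 := by exact_mod_cast h4
  have h6 : (R : ℝ) ≤ δ * q + 2 := Int.floor_le _
  linarith

/-- Every target residue `0 ≤ r ≤ δ q - 2` is attained: with `u` the inverse of `p` mod `q`, the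
index `j ≡ (r - s) u` satisfies `s + j p ≡ r`, and the error 2 keeps it a hit. Nonnegative targets
suffice. -/
theorem le_card_blockHits {β γ δ : ℝ} {p : ℤ} {q : ℕ} (hq : 0 < q) (hpq : IsCoprime p (q : ℤ))
    (hβ : |q * β - p| ≤ 1 / q) (hδ : δ ≤ 1) (hδq : 2 ≤ δ * q) (a : ℕ) :
    δ * q - 2 ≤ ((blockHits β γ δ q a).card : ℝ) := by
  have hq' : (0 : ℝ) < q := by exact_mod_cast hq
  have hqz : (0 : ℤ) < q := by exact_mod_cast hq
  set s : ℤ := ⌊(q : ℝ) * (a * β - γ)⌋ with hs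
  set R : ℕ := ⌊δ * q - 2⌋₊ with hR
  have hRle : (R : ℝ) ≤ δ * q - 2 := Nat.floor_le (by linarith)
  -- Because `δ ≤ 1`, the targets `0, ..., R` are pairwise incongruent mod `q`; injectivity of `g`
  -- rests on this.
  have hRq : R < q := by
    have : (R : ℝ) < q := by nlinarith
    exact_mod_cast this
  obtain ⟨u, v, huv⟩ := hpq
  let g : ℕ → ℕ := fun r => (((r - s) * u) % (q : ℤ)).toNat
  have hg : ∀ r, ((g r : ℕ) : ℤ) = ((r - s) * u) % (q : ℤ) := fun r =>
    Int.toNat_of_nonneg (Int.emod_nonneg _ hqz.ne')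
  have hgq : ∀ r, g r < q := fun r => by
    have := Int.emod_lt_of_pos ((r - s) * u) hqz
    have := hg r
    omega
  have hgm : ∀ r : ℕ, ∃ m : ℤ, s + (g r : ℤ) * p - r = q * m := by
    intro r
    refine ⟨-(((r : ℤ) - s) * u / q) * p - (r - s) * v, ?_⟩
    have h1 := Int.emod_add_mul_ediv (((r : ℤ) - s) * u) q
    rw [← hg r] at h1
    linear_combination p * h1 + ((r : ℤ) - s) * huv
  have hmaps : ∀ r ∈ Finset.range (R + 1), g r ∈ blockHits β γ δ q a := by
    intro r hr
    have hrR : (r : ℝ) ≤ R := by exact_mod_cast Nat.lt_succ_iff.1 (Finset.mem_range.1 hr)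
    refine Finset.mem_filter.2 ⟨Finset.mem_range.2 (hgq r), ?_⟩
    obtain ⟨m, hm⟩ := hgm r
    refine (distInt_le_abs_sub _ m).trans ?_
    have h1 := abs_block_sub_le (γ := γ) hq hβ a (g r) (hgq r)
    rw [← hs] at h1
    have hm' : (s : ℝ) + (g r : ℝ) * p - r = q * m := by exact_mod_cast hm
    have hr0 : (0 : ℝ) ≤ r := Nat.cast_nonneg r
    have h2 : (q : ℝ) * |((a + g r : ℕ) : ℝ) * β - γ - m| ≤ q * δ := by
      rw [← Nat.abs_cast q, ← abs_mul, Nat.abs_cast]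
      rw [abs_le] at h1 ⊢
      push_cast at h1 ⊢
      constructor <;> nlinarith
    exact le_of_mul_le_mul_left h2 hq'
  have hinj : Set.InjOn g (Finset.range (R + 1)) := by
    intro i hi j hj hij
    have hi' := Finset.mem_range.1 (Finset.mem_coe.1 hi)
    have hj' := Finset.mem_range.1 (Finset.mem_coe.1 hj)
    obtain ⟨m, hm⟩ := hgm i
    obtain ⟨m', hm'⟩ := hgm j
    rw [hij] at hm
    have h : (q : ℤ) ∣ (i : ℤ) - j := ⟨m' - m, by linarith⟩
    have h0 := Int.eq_zero_of_abs_lt_dvd h (by rw [abs_lt]; omega)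
    omega
  have hcard := Finset.card_le_card_of_injOn g hmaps hinj
  rw [Finset.card_range] at hcard
  have h5 : (R : ℝ) + 1 ≤ ((blockHits β γ δ q a).card : ℝ) := by exact_mod_cast hcard
  have h6 : δ * q - 2 < R + 1 := Nat.lt_floor_add_one _
  linarith

/-! ### Hits in an initial segment. -/

/-- The `n ∈ [1, M]` with `‖n β - γ‖ ≤ δ`. -/
noncomputable def hits (β γ δ : ℝ) (M : ℕ) : Finset ℕ :=
  (Finset.Icc 1 M).filter fun n : ℕ => distInt ((n : ℝ) * β - γ) ≤ δ

theorem mem_hits {β γ δ : ℝ} {M n : ℕ} :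
    n ∈ hits β γ δ M ↔ (1 ≤ n ∧ n ≤ M) ∧ distInt ((n : ℝ) * β - γ) ≤ δ := by
  simp [hits]

/-- Counting a set of integers in `k` consecutive blocks of length `q`. -/
theorem card_filter_blocks (P : ℕ → Prop) [DecidablePred P] (q k a : ℕ) :
    ((Finset.Ico a (a + k * q)).filter P).card =
      ∑ i ∈ Finset.range k, ((Finset.range q).filter fun j => P (a + i * q + j)).card := by
  induction k with
  | zero => simp
  | succ k ih =>
    rw [Finset.sum_range_succ, ← ih]
    have hsplit : Finset.Ico a (a + (k + 1) * q) =
        Finset.Ico a (a + k * q) ∪ Finset.Ico (a + k * q) (a + k * q + q) := by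
      rw [Finset.Ico_union_Ico_eq_Ico (by omega) (by omega)]
      congr 1
      ring
    rw [hsplit, Finset.filter_union, Finset.card_union_of_disjoint
      (Finset.disjoint_filter_filter (Finset.Ico_disjoint_Ico_consecutive _ _ _))]
    congr 1
    symm
    refine Finset.card_bij (fun j _ => a + k * q + j) ?_ ?_ ?_
    · intro j hj
      simp only [Finset.mem_filter, Finset.mem_range, Finset.mem_Ico] at hj ⊢
      exact ⟨by omega, hj.2⟩
    · intro i _ j _ h
      omega
    · intro n hn
      simp only [Finset.mem_filter, Finset.mem_Ico] at hn
      refine ⟨n - (a + k * q), ?_, by omega⟩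
      simp only [Finset.mem_filter, Finset.mem_range]
      refine ⟨by omega, ?_⟩
      rw [Nat.add_sub_of_le hn.1.1]
      exact hn.2

theorem card_hits_le {β γ δ : ℝ} {p : ℤ} {q M : ℕ} (hq : 0 < q) (hqM : q ≤ M)
    (hpq : IsCoprime p (q : ℤ)) (hβ : |q * β - p| ≤ 1 / q) (hδ : 0 ≤ δ) :
    ((hits β γ δ M).card : ℝ) ≤ M * (4 * δ + 10 / q) := by
  classical
  have hq' : (0 : ℝ) < q := by exact_mod_cast hq
  have hsub : hits β γ δ M ⊆ (Finset.Ico 0 (0 + (M / q + 1) * q)).filter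
      fun n : ℕ => distInt ((n : ℝ) * β - γ) ≤ δ := by
    intro n hn
    obtain ⟨⟨_, h2⟩, h3⟩ := mem_hits.1 hn
    refine Finset.mem_filter.2 ⟨Finset.mem_Ico.2 ⟨Nat.zero_le _, ?_⟩, h3⟩
    have := Nat.lt_div_mul_add (a := M) hq
    rw [add_mul]
    omega
  have h1 := Finset.card_le_card hsub
  rw [card_filter_blocks] at h1
  have h2 : ((hits β γ δ M).card : ℝ) ≤ ∑ i ∈ Finset.range (M / q + 1),
      ((blockHits β γ δ q (0 + i * q)).card : ℝ) := by
    exact_mod_cast h1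
  have h3 := Finset.sum_le_sum fun i (_ : i ∈ Finset.range (M / q + 1)) =>
    card_blockHits_le (γ := γ) hq hpq hβ hδ (0 + i * q)
  rw [Finset.sum_const, Finset.card_range, nsmul_eq_mul] at h3
  -- Rounding up to whole blocks at most doubles the count, since `q ≤ M`.
  have h4 : ((M / q + 1 : ℕ) : ℝ) ≤ 2 * (M / q) := by
    have h5 : ((M / q : ℕ) : ℝ) ≤ M / q := Nat.cast_div_le
    have h6 : (1 : ℝ) ≤ M / q := by
      rw [one_le_div hq']
      exact_mod_cast hqM
    push_cast
    linarith
  calc ((hits β γ δ M).card : ℝ) ≤ ((M / q + 1 : ℕ) : ℝ) * (2 * δ * q + 5) := h2.trans h3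
    _ ≤ 2 * (M / q) * (2 * δ * q + 5) := by gcongr
    _ = M * (4 * δ + 10 / q) := by field_simp; ring

theorem le_card_hits {β γ δ : ℝ} {p : ℤ} {q M : ℕ} (hq : 0 < q) (hqM : q ≤ M)
    (hpq : IsCoprime p (q : ℤ)) (hβ : |q * β - p| ≤ 1 / q) (hδ : δ ≤ 1) (hδq : 4 ≤ δ * q) :
    δ * M / 4 ≤ ((hits β γ δ M).card : ℝ) := by
  classical
  have hq' : (0 : ℝ) < q := by exact_mod_cast hq
  have hδ0 : 0 < δ := by by_contra h; nlinarith
  have hsub : ((Finset.Ico 1 (1 + (M / q) * q)).filter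
      fun n : ℕ => distInt ((n : ℝ) * β - γ) ≤ δ) ⊆ hits β γ δ M := by
    intro n hn
    obtain ⟨h1, h3⟩ := Finset.mem_filter.1 hn
    rw [Finset.mem_Ico] at h1
    have := Nat.div_mul_le_self M q
    exact mem_hits.2 ⟨by omega, h3⟩
  have h1 := Finset.card_le_card hsub
  rw [card_filter_blocks] at h1
  have h2 : ∑ i ∈ Finset.range (M / q), ((blockHits β γ δ q (1 + i * q)).card : ℝ)
      ≤ ((hits β γ δ M).card : ℝ) := by
    exact_mod_cast h1
  have h3 := Finset.sum_le_sum fun i (_ : i ∈ Finset.range (M / q)) =>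
    le_card_blockHits (γ := γ) hq hpq hβ hδ (by linarith) (1 + i * q)
  rw [Finset.sum_const, Finset.card_range, nsmul_eq_mul] at h3
  -- Keeping only complete blocks loses at most half of `M / q`; `4 ≤ δ q` likewise gives `δ q - 2 ≥
  -- δ q / 2`. Hence the factor `1 / 4`.
  have h4 : (M : ℝ) / q / 2 ≤ ((M / q : ℕ) : ℝ) := by
    have h5 : M ≤ 2 * (M / q * q) := by
      have h6 := Nat.lt_div_mul_add (a := M) hq
      have h7 : 1 * q ≤ M / q * q := Nat.mul_le_mul_right q (Nat.div_pos hqM hq)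
      omega
    have h8 : (M : ℝ) ≤ 2 * ((M / q : ℕ) * q) := by exact_mod_cast h5
    rw [div_div, div_le_iff₀ (by positivity)]
    linarith
  calc δ * M / 4 = (M : ℝ) / q / 2 * (δ * q / 2) := by field_simp; ring
    _ ≤ ((M / q : ℕ) : ℝ) * (δ * q - 2) := by
      apply mul_le_mul h4 (by linarith) (by positivity) (by positivity)
    _ ≤ _ := h3.trans h2

/-! ### Diophantine lower bounds for `‖n α‖`. -/

theorem distInt_mul_pos {α : ℝ} (hirr : Irrational α) {n : ℕ} (hn : 1 ≤ n) :
    0 < distInt (n * α) := by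
  refine abs_pos.2 (sub_ne_zero.2 fun h => ?_)
  exact (hirr.natCast_mul (by omega : n ≠ 0)) ⟨round ((n : ℝ) * α), by rw [h]; simp⟩

theorem exponentSet_bddAbove {α : ℝ} (hirr : Irrational α) (hL : ¬ Liouville α) :
    BddAbove (exponentSet α) := by
  rw [Liouville] at hL
  push Not at hL
  obtain ⟨m, hm⟩ := hL
  refine ⟨m, fun w hw => ?_⟩
  by_contra hlt
  push Not at hlt
  apply hw.2
  -- The negated Liouville condition concerns only denominators above 1, so `n = 1` has to be left
  -- as a possible exception.
  refine (Set.finite_le_nat 1).subset fun n hn => ?_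
  obtain ⟨hn1, hn2⟩ := hn
  by_contra hgt
  have hn' : 1 < n := by simpa using hgt
  have hnR : (1 : ℝ) < n := by exact_mod_cast hn'
  have hne : α ≠ ((round ((n : ℝ) * α) : ℤ) : ℝ) / ((n : ℤ) : ℝ) := fun h =>
    hirr ⟨(round ((n : ℝ) * α) : ℚ) / (n : ℚ), by rw [eq_comm]; push_cast at h ⊢; exact h⟩
  have h1 := hm (round ((n : ℝ) * α)) n (by exact_mod_cast hn') hne
  have h2 : distInt (n * α) = n * |α - ((round ((n : ℝ) * α) : ℤ) : ℝ) / ((n : ℤ) : ℝ)| := by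
    rw [distInt, ← Nat.abs_cast n, ← abs_mul, Nat.abs_cast]
    congr 1
    push_cast
    field_simp
  have h3 : (n : ℝ) ^ (-w) ≤ 1 / ((n : ℤ) : ℝ) ^ m := by
    rw [Real.rpow_neg (by linarith), one_div]
    push_cast
    rw [← Real.rpow_natCast]
    gcongr
    exact hnR.le
  have h4 : |α - ((round ((n : ℝ) * α) : ℤ) : ℝ) / ((n : ℤ) : ℝ)| ≤ distInt (n * α) := by
    rw [h2]
    exact le_mul_of_one_le_left (abs_nonneg _) hnR.le
  linarith

theorem diophExponent_nonneg (α : ℝ) : 0 ≤ diophExponent α :=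
  Real.sSup_nonneg fun _ hw => hw.1.le

/-- A lower bound `κ n ^ (-(1 + μ))` for `‖n α‖`, valid for all `n ≥ 1`. -/
theorem exists_le_distInt {α : ℝ} (hirr : Irrational α) (hL : ¬ Liouville α) :
    ∃ κ : ℝ, 0 < κ ∧ ∀ n : ℕ, 1 ≤ n →
      κ * (n : ℝ) ^ (-(1 + diophExponent α)) ≤ distInt (n * α) := by
  set l := 1 + diophExponent α with hl
  have hl0 : 0 < l := by linarith [diophExponent_nonneg α]
  -- The exponent `l` exceeds the supremum, so only finitely many `n` violate the bound with
  -- constant 1; their smallest `‖n α‖` supplies `κ`.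
  have hfin : {n : ℕ | 1 ≤ n ∧ distInt (n * α) < (n : ℝ) ^ (-l)}.Finite := by
    by_contra hinf
    have : l ≤ diophExponent α := le_csSup (exponentSet_bddAbove hirr hL) ⟨hl0, hinf⟩
    linarith
  have hmin : ∃ κ : ℝ, 0 < κ ∧ κ ≤ 1 ∧ ∀ n ∈ hfin.toFinset, κ ≤ distInt (n * α) := by
    have : ∀ s : Finset ℕ, (∀ n ∈ s, 1 ≤ n) →
        ∃ κ : ℝ, 0 < κ ∧ κ ≤ 1 ∧ ∀ n ∈ s, κ ≤ distInt (n * α) := by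
      intro s
      induction s using Finset.induction_on with
      | empty => exact fun _ => ⟨1, one_pos, le_rfl, by simp⟩
      | insert a s ha ih =>
        intro hs
        obtain ⟨κ, h0, h1, h2⟩ := ih fun n hn => hs n (Finset.mem_insert_of_mem hn)
        refine ⟨min κ (distInt (a * α)),
          lt_min h0 (distInt_mul_pos hirr (hs a (Finset.mem_insert_self _ _))),
          (min_le_left _ _).trans h1, fun n hn => ?_⟩
        rcases Finset.mem_insert.1 hn with rfl | hn
        · exact min_le_right _ _
        · exact (min_le_left _ _).trans (h2 n hn)
    exact this _ fun n hn => (hfin.mem_toFinset.1 hn).1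
  obtain ⟨κ, h0, h1, h2⟩ := hmin
  refine ⟨κ, h0, fun n hn => ?_⟩
  have hn' : (1 : ℝ) ≤ n := by exact_mod_cast hn
  by_cases hc : distInt (n * α) < (n : ℝ) ^ (-l)
  · have h3 : (n : ℝ) ^ (-l) ≤ 1 := Real.rpow_le_one_of_one_le_of_nonpos hn' (by linarith)
    have h4 := h2 n (hfin.mem_toFinset.2 ⟨hn, hc⟩)
    nlinarith
  · push Not at hc
    have h3 : 0 < (n : ℝ) ^ (-l) := Real.rpow_pos_of_pos (by linarith) _
    nlinarith

theorem eps_pos (α : ℝ) : 0 < eps α := by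
  have := diophExponent_nonneg α
  unfold eps
  positivity

theorem eps_le (α : ℝ) : eps α ≤ 1 / 10 := by
  have := diophExponent_nonneg α
  unfold eps
  apply one_div_le_one_div_of_le <;> linarith

/-! ### Uniform hit counts for `d α`. -/

/-- Rational approximations to `d α` with large denominators, uniformly in `d ≤ N ^ ε`. -/
theorem exists_large_denominator {α : ℝ} (hirr : Irrational α) (hL : ¬ Liouville α) :
    ∃ κ : ℝ, 0 < κ ∧ ∀ N d : ℕ, 1 ≤ N → 1 ≤ d → (d : ℝ) ≤ (N : ℝ) ^ eps α →
      ∃ (p : ℤ) (q : ℕ), 0 < q ∧ q ≤ N / d ∧ IsCoprime p (q : ℤ) ∧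
        |q * (d * α) - p| ≤ 1 / q ∧ κ * (N : ℝ) ^ (8 * eps α) ≤ q := by
  obtain ⟨κ, hκ, hκn⟩ := exists_le_distInt hirr hL
  set l := 1 + diophExponent α with hl
  have hl1 : 1 ≤ l := by linarith [diophExponent_nonneg α]
  have hle : eps α * l = 1 / 10 := by unfold eps; rw [← hl]; field_simp
  have he := eps_pos α
  have he' := eps_le α
  refine ⟨κ ^ (1 / l), Real.rpow_pos_of_pos hκ _, fun N d hN hd hdN => ?_⟩
  have hNR : (1 : ℝ) ≤ N := by exact_mod_cast hN
  have hN0 : (0 : ℝ) < N := by linarith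
  have hdR : (1 : ℝ) ≤ d := by exact_mod_cast hd
  have hdN' : d ≤ N := by
    have h1 : (N : ℝ) ^ eps α ≤ (N : ℝ) ^ (1 : ℝ) :=
      Real.rpow_le_rpow_of_exponent_le hNR (by linarith)
    rw [Real.rpow_one] at h1
    exact_mod_cast hdN.trans h1
  have hM : 0 < N / d := Nat.div_pos hdN' hd
  obtain ⟨r, hr1, hr2⟩ := Real.exists_rat_abs_sub_le_and_den_le (d * α) hM
  have hq : 0 < r.den := r.den_pos
  have hqR : (0 : ℝ) < r.den := by exact_mod_cast hq
  have hkey : |(r.den : ℝ) * (d * α) - r.num| ≤ 1 / ((N / d : ℕ) + 1) := by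
    have h1 : (r.den : ℝ) * (d * α) - r.num = r.den * (d * α - r) := by
      rw [mul_sub, mul_comm _ (r : ℝ), ← Rat.cast_natCast, ← Rat.cast_mul, Rat.mul_den_eq_num]
      simp
    rw [h1, abs_mul, Nat.abs_cast]
    calc (r.den : ℝ) * |d * α - r| ≤ r.den * (1 / (((N / d : ℕ) + 1) * r.den)) := by gcongr
      _ = _ := by field_simp
  have hMd : (N : ℝ) / d ≤ (N / d : ℕ) + 1 := by
    rw [div_le_iff₀ (by linarith)]
    have := (Nat.lt_div_mul_add (a := N) hd).le
    have h2 : (N : ℝ) ≤ (N / d : ℕ) * d + d := by exact_mod_cast this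
    linarith
  refine ⟨r.num, r.den, hq, hr2, ?_, ?_, ?_⟩
  · rw [Int.isCoprime_iff_gcd_eq_one]
    exact r.reduced
  · refine hkey.trans (one_div_le_one_div_of_le hqR ?_)
    have : (r.den : ℝ) ≤ (N / d : ℕ) := by exact_mod_cast hr2
    linarith
  · have h1 := hκn (r.den * d) (Nat.mul_pos hq hd)
    have h2 : distInt (((r.den * d : ℕ) : ℝ) * α) ≤ 1 / (N / d) := by
      refine (distInt_le_abs_sub _ r.num).trans ?_
      push_cast
      rw [mul_assoc]
      exact hkey.trans (one_div_le_one_div_of_le (by positivity) hMd)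
    have hx : (0 : ℝ) < ((r.den * d : ℕ) : ℝ) := by push_cast; positivity
    -- Compare the two bounds `κ (q d) ^ (-l) ≤ ‖q d α‖ ≤ d / N`: an approximation this good forces
    -- `q d` to be large.
    have h3 : κ * (N / d) ≤ ((r.den * d : ℕ) : ℝ) ^ l := by
      have h4 := h1.trans h2
      rw [Real.rpow_neg hx.le, ← div_eq_mul_inv,
        div_le_div_iff₀ (Real.rpow_pos_of_pos hx _) (by positivity)] at h4
      linarith
    have h5 : κ * (N : ℝ) ^ (1 - eps α) ≤ ((r.den * d : ℕ) : ℝ) ^ l := by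
      refine le_trans ?_ h3
      rw [Real.rpow_sub hN0, Real.rpow_one]
      gcongr
    have h6 := Real.rpow_le_rpow (by positivity) h5 (by positivity : 0 ≤ 1 / l)
    rw [← Real.rpow_mul hx.le, mul_one_div_cancel (by positivity), Real.rpow_one,
      Real.mul_rpow hκ.le (by positivity), ← Real.rpow_mul hN0.le] at h6
    -- Here `1 / l = 10 ε`, and `10 ε (1 - ε) ≥ 9 ε` because `ε ≤ 1 / 10`. Dividing out `d ≤ N ^ ε`
    -- below leaves the exponent `8 ε`.
    have h7 : (N : ℝ) ^ (9 * eps α) ≤ (N : ℝ) ^ ((1 - eps α) * (1 / l)) := by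
      apply Real.rpow_le_rpow_of_exponent_le hNR
      rw [mul_one_div, le_div_iff₀ (by positivity)]
      nlinarith
    have h8 : (N : ℝ) ^ (9 * eps α) = (N : ℝ) ^ (8 * eps α) * (N : ℝ) ^ eps α := by
      rw [← Real.rpow_add hN0]
      ring_nf
    have hne : 0 < (N : ℝ) ^ eps α := Real.rpow_pos_of_pos hN0 _
    have hκl : 0 < κ ^ (1 / l) := Real.rpow_pos_of_pos hκ _
    have h9 : κ ^ (1 / l) * (N : ℝ) ^ (8 * eps α) * (N : ℝ) ^ eps α ≤ r.den * (N : ℝ) ^ eps α := by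
      calc _ = κ ^ (1 / l) * (N : ℝ) ^ (9 * eps α) := by rw [h8]; ring
        _ ≤ κ ^ (1 / l) * (N : ℝ) ^ ((1 - eps α) * (1 / l)) := by gcongr
        _ ≤ ((r.den * d : ℕ) : ℝ) := h6
        _ ≤ r.den * (N : ℝ) ^ eps α := by push_cast; gcongr
    exact le_of_mul_le_mul_right h9 hne

/-- Upper bound for the number of hits of `d α`, uniform in `γ` and in `d ≤ N ^ ε`. -/
theorem exists_card_hits_le {α : ℝ} (hirr : Irrational α) (hL : ¬ Liouville α) :
    ∃ C : ℝ, 0 < C ∧ ∀ (γ δ : ℝ) (N d : ℕ), 1 ≤ N → 1 ≤ d → (d : ℝ) ≤ (N : ℝ) ^ eps α →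
      (N : ℝ) ^ (-(4 * eps α)) ≤ δ →
        ((hits (d * α) γ δ (N / d)).card : ℝ) ≤ C * δ * (N / d) := by
  obtain ⟨κ, hκ, h⟩ := exists_large_denominator hirr hL
  refine ⟨4 + 10 / κ, by positivity, fun γ δ N d hN hd hdN hδ => ?_⟩
  obtain ⟨p, q, hq, hqM, hpq, happ, hbig⟩ := h N d hN hd hdN
  have hNR : (1 : ℝ) ≤ N := by exact_mod_cast hN
  have hN0 : (0 : ℝ) < N := by linarith
  have hδ0 : 0 < δ := (Real.rpow_pos_of_pos hN0 _).trans_le hδ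
  have hqR : (0 : ℝ) < q := by exact_mod_cast hq
  -- The error term is absorbed because `1 / q` is at most `N ^ (-8 ε) / κ`, while `δ ≥ N ^ (-4 ε)`.
  have h1 : 10 / (q : ℝ) ≤ 10 / κ * δ := by
    have h2 : 1 ≤ δ * (N : ℝ) ^ (8 * eps α) := by
      calc (1 : ℝ) ≤ (N : ℝ) ^ (4 * eps α) := Real.one_le_rpow hNR (by linarith [eps_pos α])
        _ = (N : ℝ) ^ (-(4 * eps α)) * (N : ℝ) ^ (8 * eps α) := by
          rw [← Real.rpow_add hN0]
          ring_nf
        _ ≤ _ := by gcongr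
    rw [div_mul_eq_mul_div, div_le_div_iff₀ hqR hκ]
    nlinarith
  refine (card_hits_le hq hqM hpq happ hδ0.le).trans ?_
  have h3 : ((N / d : ℕ) : ℝ) ≤ N / d := Nat.cast_div_le
  calc ((N / d : ℕ) : ℝ) * (4 * δ + 10 / q) ≤ (N / d) * (4 * δ + 10 / κ * δ) := by gcongr
    _ = _ := by ring

/-- Lower bound for the number of hits of `α`, uniform in `γ`. -/
theorem eventually_le_card_hits {α : ℝ} (hirr : Irrational α) (hL : ¬ Liouville α) :
    ∀ᶠ N : ℕ in Filter.atTop, ∀ γ δ : ℝ, (N : ℝ) ^ (-(4 * eps α)) ≤ δ → δ ≤ 1 →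
      δ * N / 4 ≤ ((hits α γ δ N).card : ℝ) := by
  obtain ⟨κ, hκ, h⟩ := exists_large_denominator hirr hL
  have he := eps_pos α
  have ht : Filter.Tendsto (fun N : ℕ => (N : ℝ) ^ (4 * eps α)) Filter.atTop Filter.atTop :=
    (tendsto_rpow_atTop (by positivity)).comp tendsto_natCast_atTop_atTop
  filter_upwards [ht.eventually_ge_atTop (4 / κ), Filter.eventually_ge_atTop 1]
    with N hbigN hN γ δ hδ hδ1
  have hNR : (1 : ℝ) ≤ N := by exact_mod_cast hN
  have hN0 : (0 : ℝ) < N := by linarith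
  obtain ⟨p, q, hq, hqM, hpq, happ, hbig⟩ := h N 1 hN le_rfl
    (by rw [Nat.cast_one]; exact Real.one_le_rpow hNR he.le)
  rw [Nat.div_one] at hqM
  rw [Nat.cast_one, one_mul] at happ
  refine le_card_hits hq hqM hpq happ hδ1 ?_
  have hpos := Real.rpow_pos_of_pos hN0 (-(4 * eps α))
  calc (4 : ℝ) ≤ κ * (N : ℝ) ^ (4 * eps α) := by
        rw [div_le_iff₀ hκ] at hbigN; linarith
    _ = (N : ℝ) ^ (-(4 * eps α)) * (κ * (N : ℝ) ^ (8 * eps α)) := by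
        rw [mul_left_comm, ← Real.rpow_add hN0]
        ring_nf
    _ ≤ δ * q := by gcongr; exact hpos.le.trans hδ

/-! ### The average of `φ(n) / n` over a set of hits. -/

theorem exp_neg_two_mul_le {x : ℝ} (h0 : 0 ≤ x) (h1 : x ≤ 1 / 2) : Real.exp (-(2 * x)) ≤ 1 - x := by
  have h2 := Real.add_one_le_exp (2 * x)
  rw [Real.exp_neg]
  refine (inv_anti₀ (by linarith) h2).trans ?_
  rw [inv_le_iff_one_le_mul₀ (by linarith)]
  nlinarith

/-- Each factor of the Euler product `∏ (1 - 1 / p)` is at least `exp (-2 / p)`, as `1 / p ≤ 1 / 2`.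
-/
theorem exp_neg_sum_inv_le_totient_div {n : ℕ} (hn : n ≠ 0) :
    Real.exp (-(2 * ∑ p ∈ n.primeFactors, (p : ℝ)⁻¹)) ≤ (n.totient : ℝ) / n := by
  have h1 : (n.totient : ℝ) = n * ∏ p ∈ n.primeFactors, (1 - (p : ℝ)⁻¹) := by
    have h := congrArg (Rat.cast : ℚ → ℝ) (Nat.totient_eq_mul_prod_factors n)
    push_cast at h
    exact h
  have hn' : (n : ℝ) ≠ 0 := by exact_mod_cast hn
  rw [h1, mul_div_cancel_left₀ _ hn', Finset.mul_sum, ← Finset.sum_neg_distrib, Real.exp_sum]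
  refine Finset.prod_le_prod (fun _ _ => (Real.exp_pos _).le) fun p hp => ?_
  have hp2 : (2 : ℝ) ≤ p := by exact_mod_cast (Nat.prime_of_mem_primeFactors hp).two_le
  refine exp_neg_two_mul_le (by positivity) ?_
  rw [one_div]
  exact inv_anti₀ (by norm_num) hp2

theorem card_primeFactors_mul_log_two_le {n : ℕ} (hn : n ≠ 0) :
    (n.primeFactors.card : ℝ) * Real.log 2 ≤ Real.log n := by
  have h1 : 2 ^ n.primeFactors.card ≤ n := by
    calc 2 ^ n.primeFactors.card = ∏ _p ∈ n.primeFactors, 2 := by simp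
      _ ≤ ∏ p ∈ n.primeFactors, p :=
        Finset.prod_le_prod' fun p hp => (Nat.prime_of_mem_primeFactors hp).two_le
      _ ≤ n := Nat.le_of_dvd (Nat.pos_of_ne_zero hn) (Nat.prod_primeFactors_dvd n)
  rw [← Real.log_pow]
  exact Real.log_le_log (by positivity) (by exact_mod_cast h1)

/-- The prime divisors of `n` above `y` contribute at most `1` to `∑ 1 / p` once `y` is at least
`log n / log 2`. -/
theorem sum_inv_primeFactors_le {n : ℕ} (hn : n ≠ 0) {y : ℝ} (hy : 0 < y)
    (hlog : Real.log n ≤ y * Real.log 2) :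
    ∑ p ∈ n.primeFactors, (p : ℝ)⁻¹ ≤
      ∑ d ∈ Finset.Icc 1 ⌊y⌋₊, (if d ∣ n then (d : ℝ)⁻¹ else 0) + 1 := by
  rw [← Finset.sum_filter_add_sum_filter_not n.primeFactors (fun p => p ≤ ⌊y⌋₊)]
  refine add_le_add ?_ ?_
  -- Small primes are enlarged to all divisors up to `y`; the loss is harmless since `∑ 1 / d ^ 2`
  -- over all `d` still converges.
  · rw [← Finset.sum_filter]
    refine Finset.sum_le_sum_of_subset_of_nonneg (fun p hp => ?_) fun _ _ _ => by positivity
    obtain ⟨h1, h2⟩ := Finset.mem_filter.1 hp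
    exact Finset.mem_filter.2 ⟨Finset.mem_Icc.2 ⟨(Nat.prime_of_mem_primeFactors h1).one_le, h2⟩,
      Nat.dvd_of_mem_primeFactors h1⟩
  -- There are at most `log n / log 2 ≤ y` large primes, each contributing at most `1 / y`.
  · have h1 : ∀ p ∈ n.primeFactors.filter (fun p => ¬ p ≤ ⌊y⌋₊), (p : ℝ)⁻¹ ≤ y⁻¹ := by
      intro p hp
      have h2 := (Finset.mem_filter.1 hp).2
      exact inv_anti₀ hy (Nat.lt_of_floor_lt (not_le.1 h2)).le
    refine (Finset.sum_le_card_nsmul _ _ _ h1).trans ?_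
    rw [nsmul_eq_mul, ← div_eq_mul_inv, div_le_one hy]
    have h3 : ((n.primeFactors.filter (fun p => ¬ p ≤ ⌊y⌋₊)).card : ℝ) ≤ n.primeFactors.card := by
      exact_mod_cast Finset.card_filter_le _ _
    have h4 := (card_primeFactors_mul_log_two_le hn).trans hlog
    exact h3.trans (le_of_mul_le_mul_right h4 (Real.log_pos one_lt_two))

/-- Writing `n = d k` turns `n α` into `k (d α)`; this is why counts for `d α` are needed. -/
theorem card_filter_dvd_hits_le (α γ δ : ℝ) (N d : ℕ) (hd : 1 ≤ d) :
    ((hits α γ δ N).filter (fun n => d ∣ n)).card ≤ (hits (d * α) γ δ (N / d)).card := by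
  refine Finset.card_le_card_of_injOn (fun n => n / d) (fun n hn => ?_) fun m hm n hn hmn => ?_
  · obtain ⟨h1, k, rfl⟩ := Finset.mem_filter.1 hn
    obtain ⟨⟨h2, h3⟩, h4⟩ := mem_hits.1 h1
    simp only [Nat.mul_div_cancel_left k hd]
    refine mem_hits.2 ⟨⟨Nat.pos_of_mul_pos_left h2, ?_⟩, ?_⟩
    · rw [Nat.le_div_iff_mul_le hd, mul_comm]
      exact h3
    · push_cast at h4
      rwa [← mul_assoc, mul_comm (k : ℝ)]
  · have h1 := (Finset.mem_filter.1 (Finset.mem_coe.1 hm)).2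
    have h2 := (Finset.mem_filter.1 (Finset.mem_coe.1 hn)).2
    exact (Nat.div_left_inj h1 h2).1 hmn

theorem sum_Icc_inv_sq_le_two (D : ℕ) : ∑ d ∈ Finset.Icc 1 D, ((d : ℝ) ^ 2)⁻¹ ≤ 2 := by
  rcases Nat.eq_zero_or_pos D with rfl | hD
  · simp
  · rw [← Finset.add_sum_Ioc_eq_sum_Icc hD]
    have h1 := sum_Ioc_inv_sq_le_sub (α := ℝ) one_ne_zero hD
    have h2 : (0 : ℝ) ≤ (D : ℝ)⁻¹ := by positivity
    norm_num at h1 ⊢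
    linarith

/-- After interchanging sums, each `d ≤ N ^ ε` has weight `1 / d` and at most `C δ N / d` multiples
among the hits, so `∑ 1 / d ^ 2 ≤ 2` gives the first term. Prime divisors above `N ^ ε` add at most
1 per element of `S`. -/
theorem sum_sum_inv_primeFactors_le {α γ δ C : ℝ} {N : ℕ} (hN : 1 ≤ N)
    (hlog : Real.log N ≤ (N : ℝ) ^ eps α * Real.log 2) (hδ : 0 ≤ δ) (hC : 0 ≤ C)
    (hcount : ∀ d : ℕ, 1 ≤ d → (d : ℝ) ≤ (N : ℝ) ^ eps α →
      ((hits (d * α) γ δ (N / d)).card : ℝ) ≤ C * δ * (N / d))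
    {S : Finset ℕ} (hS : S ⊆ hits α γ δ N) :
    ∑ n ∈ S, ∑ p ∈ n.primeFactors, (p : ℝ)⁻¹ ≤ 2 * C * δ * N + S.card := by
  have hN0 : (0 : ℝ) < N := by exact_mod_cast hN
  set y := (N : ℝ) ^ eps α with hy
  have hy0 : 0 < y := Real.rpow_pos_of_pos hN0 _
  have h1 : ∀ n ∈ S, ∑ p ∈ n.primeFactors, (p : ℝ)⁻¹ ≤
      ∑ d ∈ Finset.Icc 1 ⌊y⌋₊, (if d ∣ n then (d : ℝ)⁻¹ else 0) + 1 := by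
    intro n hn
    obtain ⟨⟨h2, h3⟩, _⟩ := mem_hits.1 (hS hn)
    refine sum_inv_primeFactors_le (by omega) hy0 (le_trans ?_ hlog)
    exact Real.log_le_log (by exact_mod_cast h2) (by exact_mod_cast h3)
  refine (Finset.sum_le_sum h1).trans ?_
  rw [Finset.sum_add_distrib, Finset.sum_comm]
  refine add_le_add ?_ (by simp)
  have h2 : ∀ d ∈ Finset.Icc 1 ⌊y⌋₊, ∑ n ∈ S, (if d ∣ n then (d : ℝ)⁻¹ else 0) ≤
      C * δ * N * ((d : ℝ) ^ 2)⁻¹ := by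
    intro d hd
    obtain ⟨hd1, hd2⟩ := Finset.mem_Icc.1 hd
    have hdy : (d : ℝ) ≤ y := (Nat.le_floor_iff hy0.le).1 hd2
    have hd0 : (0 : ℝ) < d := by exact_mod_cast hd1
    rw [← Finset.sum_filter, Finset.sum_const, nsmul_eq_mul]
    have h3 : ((S.filter (fun n => d ∣ n)).card : ℝ) ≤ C * δ * (N / d) := by
      refine le_trans ?_ (hcount d hd1 hdy)
      exact_mod_cast (Finset.card_le_card (Finset.filter_subset_filter _ hS)).trans
        (card_filter_dvd_hits_le α γ δ N d hd1)
    calc _ ≤ C * δ * (N / d) * (d : ℝ)⁻¹ := by gcongr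
      _ = _ := by field_simp
  refine (Finset.sum_le_sum h2).trans ?_
  rw [← Finset.mul_sum]
  have := sum_Icc_inv_sq_le_two ⌊y⌋₊
  have h4 : 0 ≤ C * δ * N := by positivity
  nlinarith

/-- Jensen's inequality in tangent-line form: `exp (-2 s) ≥ exp (-2 A) (1 + 2 A - 2 s)`, summed over
`S`, where the mean of `s` is at most `A`. -/
theorem exp_mul_card_le_sum_totient {S : Finset ℕ} (hS : ∀ n ∈ S, n ≠ 0) {A : ℝ}
    (hA : ∑ n ∈ S, ∑ p ∈ n.primeFactors, (p : ℝ)⁻¹ ≤ A * S.card) :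
    Real.exp (-(2 * A)) * S.card ≤ ∑ n ∈ S, (n.totient : ℝ) / n := by
  have h1 : ∀ n ∈ S, Real.exp (-(2 * A)) * (1 + 2 * A - 2 * ∑ p ∈ n.primeFactors, (p : ℝ)⁻¹) ≤
      (n.totient : ℝ) / n := by
    intro n hn
    refine le_trans ?_ (exp_neg_sum_inv_le_totient_div (hS n hn))
    set s := ∑ p ∈ n.primeFactors, (p : ℝ)⁻¹
    have h2 : Real.exp (-(2 * s)) = Real.exp (-(2 * A)) * Real.exp (2 * A - 2 * s) := by
      rw [← Real.exp_add]
      ring_nf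
    rw [h2]
    gcongr
    have := Real.add_one_le_exp (2 * A - 2 * s)
    linarith
  refine le_trans ?_ (Finset.sum_le_sum h1)
  rw [← Finset.mul_sum]
  gcongr
  rw [Finset.sum_sub_distrib, Finset.sum_const, nsmul_eq_mul, ← Finset.mul_sum]
  linarith

/-! ### Removing the bad set. -/

open Classical in
/-- The hits that lie outside the bad set. -/
noncomputable def goodHits (α γ δ : ℝ) (N : ℕ) : Finset ℕ :=
  (hits α γ δ N).filter fun n => n ∉ badSet α γ

theorem goodHits_subset (α γ δ : ℝ) (N : ℕ) : goodHits α γ δ N ⊆ hits α γ δ N := by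
  classical
  exact Finset.filter_subset _ _

-- A bad `n` above `√N` is a hit at scale `N ^ (-2 ε)`, as `n ^ (-4 ε) ≤ N ^ (-2 ε)`. The `n ≤ √N`
-- are few: `√N ≤ N ^ (1 - 2 ε)` since `ε ≤ 1 / 10`.
open Classical in
theorem card_badSet_le {α γ C : ℝ} {N : ℕ} (hN : 1 ≤ N)
    (hcount : ((hits α γ ((N : ℝ) ^ (-(2 * eps α))) N).card : ℝ) ≤
      C * (N : ℝ) ^ (-(2 * eps α)) * N) :
    (((Finset.Icc 1 N).filter fun n => n ∈ badSet α γ).card : ℝ) ≤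
      (C + 1) * (N : ℝ) ^ (-(2 * eps α)) * N := by
  have hNR : (1 : ℝ) ≤ N := by exact_mod_cast hN
  have hN0 : (0 : ℝ) < N := by linarith
  have he := eps_pos α
  have he' := eps_le α
  set z := (N : ℝ) ^ (1 / 2 : ℝ) with hz
  have hz0 : 0 < z := Real.rpow_pos_of_pos hN0 _
  have hsub : ((Finset.Icc 1 N).filter fun n => n ∈ badSet α γ) ⊆
      Finset.Icc 1 ⌊z⌋₊ ∪ hits α γ ((N : ℝ) ^ (-(2 * eps α))) N := by
    intro n hn
    obtain ⟨h1, -, h2⟩ := Finset.mem_filter.1 hn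
    rw [Finset.mem_Icc] at h1
    by_cases hnz : (n : ℝ) ≤ z
    · exact Finset.mem_union_left _ (Finset.mem_Icc.2 ⟨h1.1, Nat.le_floor hnz⟩)
    · refine Finset.mem_union_right _ (mem_hits.2 ⟨h1, h2.le.trans ?_⟩)
      calc (n : ℝ) ^ (-(4 * eps α)) ≤ z ^ (-(4 * eps α)) :=
            Real.rpow_le_rpow_of_nonpos hz0 (not_le.1 hnz).le (by linarith)
        _ = (N : ℝ) ^ (-(2 * eps α)) := by
            rw [hz, ← Real.rpow_mul hN0.le]
            ring_nf
  have h1 := (Finset.card_le_card hsub).trans (Finset.card_union_le _ _)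
  rw [Nat.card_Icc, Nat.add_sub_cancel] at h1
  have h2 : (((Finset.Icc 1 N).filter fun n => n ∈ badSet α γ).card : ℝ) ≤
      ⌊z⌋₊ + (hits α γ ((N : ℝ) ^ (-(2 * eps α))) N).card := by exact_mod_cast h1
  have h3 : (⌊z⌋₊ : ℝ) ≤ z := Nat.floor_le hz0.le
  have h4 : z ≤ (N : ℝ) ^ (-(2 * eps α)) * N := by
    nth_rewrite 2 [← Real.rpow_one (N : ℝ)]
    rw [← Real.rpow_add hN0]
    exact Real.rpow_le_rpow_of_exponent_le hNR (by linarith)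
  linarith

/-- At scales `δ ≥ N ^ (-ε)` the bad elements, at most `(C + 1) N ^ (1 - 2 ε)` of them, use up no
more than half of the `δ N / 4` guaranteed hits. -/
theorem le_card_goodHits {α γ δ C : ℝ} {N : ℕ} (hN : 1 ≤ N)
    (hcount : ((hits α γ ((N : ℝ) ^ (-(2 * eps α))) N).card : ℝ) ≤
      C * (N : ℝ) ^ (-(2 * eps α)) * N)
    (hlower : δ * N / 4 ≤ ((hits α γ δ N).card : ℝ))
    (hbig : 8 * (C + 1) ≤ (N : ℝ) ^ eps α) (hδ : (N : ℝ) ^ (-eps α) ≤ δ) :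
    δ * N / 8 ≤ ((goodHits α γ δ N).card : ℝ) := by
  classical
  have hN0 : (0 : ℝ) < N := by exact_mod_cast hN
  have h1 : (hits α γ δ N).card ≤ (goodHits α γ δ N).card +
      ((Finset.Icc 1 N).filter fun n => n ∈ badSet α γ).card := by
    refine (Finset.card_le_card fun n hn => ?_).trans (Finset.card_union_le _ _)
    by_cases hb : n ∈ badSet α γ
    · exact Finset.mem_union_right _
        (Finset.mem_filter.2 ⟨Finset.mem_Icc.2 (mem_hits.1 hn).1, hb⟩)
    · exact Finset.mem_union_left _ (Finset.mem_filter.2 ⟨hn, hb⟩)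
  have h2 : ((hits α γ δ N).card : ℝ) ≤ (goodHits α γ δ N).card +
      ((Finset.Icc 1 N).filter fun n => n ∈ badSet α γ).card := by exact_mod_cast h1
  have h3 := card_badSet_le hN hcount
  have hpos : 0 < (N : ℝ) ^ (-(2 * eps α)) := Real.rpow_pos_of_pos hN0 _
  have h4 : 8 * (C + 1) * (N : ℝ) ^ (-(2 * eps α)) ≤ δ := by
    calc 8 * (C + 1) * (N : ℝ) ^ (-(2 * eps α)) ≤
          (N : ℝ) ^ eps α * (N : ℝ) ^ (-(2 * eps α)) := by gcongr
      _ = (N : ℝ) ^ (-eps α) := by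
          rw [← Real.rpow_add hN0]
          ring_nf
      _ ≤ δ := hδ
  have h5 := mul_le_mul_of_nonneg_right h4 hN0.le
  linarith

/-! ### Dyadic decomposition of `1 / x`. -/

theorem sum_dyadic_le {x : ℝ} (hx : 0 < x) (K : ℕ) :
    ∑ k ∈ Finset.range K, (if x ≤ (1 / 2) ^ k then (2 : ℝ) ^ k else 0) ≤ 2 / x := by
  induction K with
  | zero => simp; positivity
  | succ K ih =>
    by_cases h : x ≤ (1 / 2) ^ K
    · calc _ ≤ ∑ k ∈ Finset.range (K + 1), (2 : ℝ) ^ k :=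
            Finset.sum_le_sum fun k _ => by split_ifs <;> first | exact le_rfl | positivity
        _ ≤ 2 * 2 ^ K := by
            rw [geom_sum_eq (by norm_num), pow_succ]
            norm_num
            linarith
        _ ≤ 2 / x := by
            rw [one_div, inv_pow] at h
            rw [div_eq_mul_inv]
            gcongr
            exact (le_inv_comm₀ hx (by positivity)).1 h
    · rw [Finset.sum_range_succ, if_neg h, add_zero]
      exact ih

/-- The last scale `k` with `x ≤ 2 ^ (-k)` already has `1 / x < 2 ^ (k + 1)`; `hK` ensures that it
lies in the range. -/
theorem one_div_le_sum_dyadic {x : ℝ} (hx : 0 < x) (hx1 : x ≤ 1) {K : ℕ} (hK : (1 / 2) ^ K < x) :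
    1 / x ≤ 2 * ∑ k ∈ Finset.range K, (if x ≤ (1 / 2) ^ k then (2 : ℝ) ^ k else 0) := by
  induction K with
  | zero => simp at hK; linarith
  | succ K ih =>
    rw [Finset.sum_range_succ]
    by_cases h : x ≤ (1 / 2) ^ K
    · rw [if_pos h]
      have h1 : 0 ≤ ∑ k ∈ Finset.range K, (if x ≤ (1 / 2) ^ k then (2 : ℝ) ^ k else 0) :=
        Finset.sum_nonneg fun k _ => by split_ifs <;> positivity
      have h2 : 1 / x ≤ 2 ^ (K + 1) := by
        rw [one_div, inv_pow] at hK
        rw [one_div]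
        exact (inv_le_comm₀ (by positivity) hx).1 hK.le
      rw [pow_succ] at h2
      linarith
    · rw [if_neg h, add_zero]
      exact ih (not_le.1 h)

theorem exists_dyadic_length {y : ℝ} (hy : 1 ≤ y) :
    ∃ K : ℕ, (1 / 2) ^ K < y⁻¹ ∧ (∀ k < K, y⁻¹ ≤ (1 / 2) ^ k) ∧
      Real.log y ≤ K ∧ (K : ℝ) ≤ 1 + 2 * Real.log y := by
  obtain ⟨n, h1, h2⟩ := exists_nat_pow_near hy one_lt_two
  have hy0 : 0 < y := by linarith
  have hl2 : Real.log 2 ≤ 1 := by linarith [Real.log_two_lt_d9]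
  have hl2' : 1 / 2 ≤ Real.log 2 := by linarith [Real.log_two_gt_d9]
  -- With `2 ^ n ≤ y < 2 ^ (n + 1)`, the scales no smaller than `1 / y` are exactly `k = 0, ..., n`.
  refine ⟨n + 1, ?_, fun k hk => ?_, ?_, ?_⟩
  · rw [one_div, inv_pow]
    exact inv_strictAnti₀ hy0 h2
  · rw [one_div, inv_pow]
    refine inv_anti₀ (by positivity) (le_trans ?_ h1)
    exact pow_le_pow_right₀ one_le_two (by omega)
  · have h3 := Real.log_le_log hy0 h2.le
    rw [Real.log_pow] at h3
    refine h3.trans (mul_le_of_le_one_right (by positivity) hl2)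
  · have h3 := Real.log_le_log (by positivity) h1
    rw [Real.log_pow] at h3
    have h4 : (n : ℝ) * (1 / 2) ≤ n * Real.log 2 := by gcongr
    push_cast
    linarith

theorem rpow_neg_le_distInt_of_notMem_badSet {α γ : ℝ} {n N : ℕ} (hn : 1 ≤ n) (hnN : n ≤ N)
    (hb : n ∉ badSet α γ) : (N : ℝ) ^ (-(4 * eps α)) ≤ distInt (n * α - γ) := by
  have h1 : (n : ℝ) ^ (-(4 * eps α)) ≤ distInt (n * α - γ) := by
    by_contra h
    exact hb ⟨hn, not_le.1 h⟩
  refine le_trans ?_ h1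
  exact Real.rpow_le_rpow_of_nonpos (by exact_mod_cast hn) (by exact_mod_cast hnN)
    (by linarith [eps_pos α])

theorem distInt_pos_of_notMem_badSet {α γ : ℝ} {n : ℕ} (hn : 1 ≤ n) (hb : n ∉ badSet α γ) :
    0 < distInt (n * α - γ) :=
  (Real.rpow_pos_of_pos (by exact_mod_cast hn) _).trans_le
    (rpow_neg_le_distInt_of_notMem_badSet hn le_rfl hb)

open Classical in
/-- Interchanging the sum over `n` with the dyadic decomposition. -/
theorem sum_mul_dyadic_eq (α γ : ℝ) (N K : ℕ) (w : ℕ → ℝ) :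
    ∑ n ∈ (Finset.Icc 1 N).filter (fun n => n ∉ badSet α γ), w n *
        ∑ k ∈ Finset.range K, (if distInt (n * α - γ) ≤ (1 / 2) ^ k then (2 : ℝ) ^ k else 0) =
      ∑ k ∈ Finset.range K, 2 ^ k * ∑ n ∈ goodHits α γ ((1 / 2) ^ k) N, w n := by
  classical
  simp_rw [Finset.mul_sum]
  rw [Finset.sum_comm]
  refine Finset.sum_congr rfl fun k _ => ?_
  have h : goodHits α γ ((1 / 2) ^ k) N =
      ((Finset.Icc 1 N).filter (fun n => n ∉ badSet α γ)).filter
        (fun n : ℕ => distInt (n * α - γ) ≤ (1 / 2) ^ k) := by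
    ext n
    simp only [goodHits, hits, Finset.mem_filter]
    tauto
  rw [h, Finset.sum_filter (fun n : ℕ => distInt (n * α - γ) ≤ (1 / 2) ^ k)]
  refine Finset.sum_congr rfl fun n _ => ?_
  split_ifs <;> ring

/-! ### Bounds for the two sums. -/

theorem T_le {α γ C : ℝ} {N : ℕ} (hN : 1 ≤ N) (hlogN : 1 ≤ Real.log N) (hC : 0 ≤ C)
    (hcount : ∀ δ : ℝ, (N : ℝ) ^ (-(4 * eps α)) ≤ δ →
      ((hits α γ δ N).card : ℝ) ≤ C * δ * N) :
    T α γ N ≤ 4 * C * (N * Real.log N) := by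
  classical
  have hNR : (1 : ℝ) ≤ N := by exact_mod_cast hN
  have hN0 : (0 : ℝ) < N := by linarith
  have he := eps_pos α
  have he' := eps_le α
  obtain ⟨K, hK1, hK2, -, hK3⟩ := exists_dyadic_length
    (Real.one_le_rpow hNR (by linarith : 0 ≤ 4 * eps α))
  rw [← Real.rpow_neg hN0.le] at hK1 hK2
  rw [Real.log_rpow hN0] at hK3
  have h1 : T α γ N ≤ 2 * ∑ n ∈ (Finset.Icc 1 N).filter (fun n => n ∉ badSet α γ), 1 *
      ∑ k ∈ Finset.range K, (if distInt (n * α - γ) ≤ (1 / 2) ^ k then (2 : ℝ) ^ k else 0) := by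
    rw [T, Finset.mul_sum]
    refine Finset.sum_le_sum fun n hn => ?_
    obtain ⟨h2, h3⟩ := Finset.mem_filter.1 hn
    rw [Finset.mem_Icc] at h2
    rw [one_mul]
    refine one_div_le_sum_dyadic (distInt_pos_of_notMem_badSet h2.1 h3)
      ((distInt_le_half _).trans (by norm_num)) ?_
    exact hK1.trans_le (rpow_neg_le_distInt_of_notMem_badSet h2.1 h2.2 h3)
  rw [sum_mul_dyadic_eq] at h1
  have h2 : ∀ k ∈ Finset.range K,
      (2 : ℝ) ^ k * ∑ n ∈ goodHits α γ ((1 / 2) ^ k) N, (1 : ℝ) ≤ C * N := by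
    intro k hk
    have h3 := hcount _ (hK2 k (Finset.mem_range.1 hk))
    have h4 : ((goodHits α γ ((1 / 2) ^ k) N).card : ℝ) ≤ (hits α γ ((1 / 2) ^ k) N).card := by
      exact_mod_cast Finset.card_le_card (goodHits_subset α γ _ N)
    rw [Finset.sum_const, nsmul_one]
    calc (2 : ℝ) ^ k * ((goodHits α γ ((1 / 2) ^ k) N).card : ℝ)
        ≤ 2 ^ k * (C * (1 / 2) ^ k * N) := by gcongr; exact h4.trans h3
      _ = (2 * (1 / 2)) ^ k * (C * N) := by rw [mul_pow]; ring
      _ = C * N := by norm_num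
  have h5 := Finset.sum_le_sum h2
  rw [Finset.sum_const, Finset.card_range, nsmul_eq_mul] at h5
  -- From `K ≤ 1 + 8 ε log N`, with `ε ≤ 1 / 10` and `log N ≥ 1`.
  have h6 : (K : ℝ) ≤ 2 * Real.log N := by nlinarith
  have h7 : (K : ℝ) * (C * N) ≤ 2 * Real.log N * (C * N) := by gcongr
  linarith

/-- Only scales down to `N ^ (-ε)` are used, where good hits are plentiful; there are at least `ε
log N` of them, each contributing at least `b N`. -/
theorem le_TStar {α γ b : ℝ} {N : ℕ} (hN : 1 ≤ N) (hb : 0 ≤ b)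
    (hsum : ∀ δ : ℝ, (N : ℝ) ^ (-eps α) ≤ δ → δ ≤ 1 →
      b * δ * N ≤ ∑ n ∈ goodHits α γ δ N, (n.totient : ℝ) / n) :
    eps α * b / 2 * (N * Real.log N) ≤ TStar α γ N := by
  classical
  have hNR : (1 : ℝ) ≤ N := by exact_mod_cast hN
  have hN0 : (0 : ℝ) < N := by linarith
  obtain ⟨K, -, hK2, hK3, -⟩ := exists_dyadic_length (Real.one_le_rpow hNR (eps_pos α).le)
  rw [← Real.rpow_neg hN0.le] at hK2
  rw [Real.log_rpow hN0] at hK3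
  have h1 : 1 / 2 * ∑ n ∈ (Finset.Icc 1 N).filter (fun n => n ∉ badSet α γ),
      (n.totient : ℝ) / n * ∑ k ∈ Finset.range K,
        (if distInt (n * α - γ) ≤ (1 / 2) ^ k then (2 : ℝ) ^ k else 0) ≤ TStar α γ N := by
    rw [TStar, Finset.mul_sum]
    refine Finset.sum_le_sum fun n hn => ?_
    obtain ⟨h2, h3⟩ := Finset.mem_filter.1 hn
    rw [Finset.mem_Icc] at h2
    have h4 := sum_dyadic_le (distInt_pos_of_notMem_badSet h2.1 h3) K
    calc _ ≤ 1 / 2 * ((n.totient : ℝ) / n * (2 / distInt (n * α - γ))) := by gcongr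
      _ = _ := by rw [div_mul_div_comm]; ring
  rw [sum_mul_dyadic_eq] at h1
  refine le_trans ?_ h1
  have h2 : ∀ k ∈ Finset.range K,
      b * N ≤ (2 : ℝ) ^ k * ∑ n ∈ goodHits α γ ((1 / 2) ^ k) N, (n.totient : ℝ) / n := by
    intro k hk
    have h3 := hsum _ (hK2 k (Finset.mem_range.1 hk)) (pow_le_one₀ (by norm_num) (by norm_num))
    calc b * N = (2 * (1 / 2)) ^ k * (b * N) := by norm_num
      _ = (2 : ℝ) ^ k * (b * (1 / 2) ^ k * N) := by rw [mul_pow]; ring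
      _ ≤ _ := by gcongr
  have h5 := Finset.sum_le_sum h2
  rw [Finset.sum_const, Finset.card_range, nsmul_eq_mul] at h5
  have h6 : eps α * Real.log N * (b * N) ≤ K * (b * N) := by gcongr
  linarith

theorem TStar_le_T (α γ : ℝ) (N : ℕ) : TStar α γ N ≤ T α γ N := by
  classical
  refine Finset.sum_le_sum fun n hn => ?_
  obtain ⟨h2, h3⟩ := Finset.mem_filter.1 hn
  rw [Finset.mem_Icc] at h2
  have hn0 : (0 : ℝ) < n := by exact_mod_cast h2.1
  have h4 : (n.totient : ℝ) / n ≤ 1 := by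
    rw [div_le_one hn0]
    exact_mod_cast Nat.totient_le n
  rw [← div_div]
  exact div_le_div_of_nonneg_right h4 (distInt_nonneg _)

theorem eventually_log_le (α : ℝ) :
    ∀ᶠ N : ℕ in Filter.atTop, Real.log N ≤ (N : ℝ) ^ eps α * Real.log 2 := by
  have h := ((isLittleO_log_rpow_atTop (eps_pos α)).comp_tendsto
    tendsto_natCast_atTop_atTop).bound (Real.log_pos one_lt_two)
  filter_upwards [h] with N hN
  have h1 : 0 ≤ (N : ℝ) ^ eps α := Real.rpow_nonneg (Nat.cast_nonneg N) _
  simp only [Function.comp_apply, Real.norm_eq_abs, abs_of_nonneg h1] at hN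
  linarith [le_abs_self (Real.log N)]

theorem exists_T_le {α : ℝ} (hirr : Irrational α) (hL : ¬ Liouville α) :
    ∃ C : ℝ, 0 < C ∧ ∀ᶠ N : ℕ in Filter.atTop, ∀ γ : ℝ, T α γ N ≤ C * (N * Real.log N) := by
  obtain ⟨C, hC, hcount⟩ := exists_card_hits_le hirr hL
  refine ⟨4 * C, by positivity, ?_⟩
  filter_upwards [Filter.eventually_ge_atTop 1,
    (Real.tendsto_log_atTop.comp tendsto_natCast_atTop_atTop).eventually_ge_atTop 1]
    with N hN hlogN γ
  refine T_le hN hlogN hC.le fun δ hδ => ?_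
  have h := hcount γ δ N 1 hN le_rfl (by
    rw [Nat.cast_one]
    exact Real.one_le_rpow (by exact_mod_cast hN) (eps_pos α).le) hδ
  simpa using h

theorem exists_le_TStar {α : ℝ} (hirr : Irrational α) (hL : ¬ Liouville α) :
    ∃ c : ℝ, 0 < c ∧ ∀ᶠ N : ℕ in Filter.atTop, ∀ γ : ℝ, c * (N * Real.log N) ≤ TStar α γ N := by
  obtain ⟨C, hC, hcount⟩ := exists_card_hits_le hirr hL
  have he := eps_pos α
  -- At least `δ N / 8` good hits exist, so the total `2 C δ N + card` of the prime sums is at most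
  -- `16 C + 1` per good hit. The `1 / 8` in `b` is the same density.
  set A := 16 * C + 1 with hA
  set b := Real.exp (-(2 * A)) / 8 with hb
  have hb0 : 0 < b := by positivity
  refine ⟨eps α * b / 2, by positivity, ?_⟩
  have ht : Filter.Tendsto (fun N : ℕ => (N : ℝ) ^ eps α) Filter.atTop Filter.atTop :=
    (tendsto_rpow_atTop he).comp tendsto_natCast_atTop_atTop
  filter_upwards [Filter.eventually_ge_atTop 1, eventually_log_le α,
    eventually_le_card_hits hirr hL, ht.eventually_ge_atTop (8 * (C + 1))]
    with N hN hlog hlower hbig γ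
  have hNR : (1 : ℝ) ≤ N := by exact_mod_cast hN
  have hN0 : (0 : ℝ) < N := by linarith
  have hpow : ∀ {s t : ℝ}, s ≤ t → (N : ℝ) ^ s ≤ (N : ℝ) ^ t :=
    fun h => Real.rpow_le_rpow_of_exponent_le hNR h
  refine le_TStar hN hb0.le fun δ hδ hδ1 => ?_
  have hδ0 : 0 < δ := (Real.rpow_pos_of_pos hN0 _).trans_le hδ
  have hδ4 : (N : ℝ) ^ (-(4 * eps α)) ≤ δ := (hpow (by linarith)).trans hδ
  have h1 := hcount γ ((N : ℝ) ^ (-(2 * eps α))) N 1 hN le_rfl (by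
    rw [Nat.cast_one]
    exact Real.one_le_rpow hNR he.le) (hpow (by linarith))
  rw [Nat.div_one, Nat.cast_one, one_mul, div_one] at h1
  have h2 := le_card_goodHits hN h1 (hlower γ δ hδ4 hδ1) hbig hδ
  have h3 := sum_sum_inv_primeFactors_le hN hlog hδ0.le hC.le
    (fun d hd hdN => hcount γ δ N d hN hd hdN hδ4) (goodHits_subset α γ δ N)
  have h4 : ∑ n ∈ goodHits α γ δ N, ∑ p ∈ n.primeFactors, (p : ℝ)⁻¹ ≤
      A * (goodHits α γ δ N).card := by
    have h5 : 16 * C * (δ * N / 8) ≤ 16 * C * (goodHits α γ δ N).card := by gcongr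
    rw [hA]
    linarith
  have h6 := exp_mul_card_le_sum_totient (fun n hn => by
    have := (mem_hits.1 (goodHits_subset α γ δ N hn)).1
    omega) h4
  refine le_trans ?_ h6
  calc b * δ * N = Real.exp (-(2 * A)) * (δ * N / 8) := by rw [hb]; ring
    _ ≤ _ := by gcongr

end FracSums

theorem mainTheorem6 (α : ℝ) (hirr : Irrational α) (hL : ¬ Liouville α) :
    ∃ c C : ℝ, 0 < c ∧ 0 < C ∧ ∃ N₀ : ℕ, ∀ γ : ℝ, ∀ N : ℕ, N₀ ≤ N →
      -- `T_N ≍ N log N`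
      (c * (N * Real.log N) ≤ FracSums.T α γ N ∧ FracSums.T α γ N ≤ C * (N * Real.log N)) ∧
      -- `T*_N ≍ N log N`
      (c * (N * Real.log N) ≤ FracSums.TStar α γ N ∧
        FracSums.TStar α γ N ≤ C * (N * Real.log N)) ∧
      -- `T_N ≍ T*_N`
      (c * FracSums.TStar α γ N ≤ FracSums.T α γ N ∧
        FracSums.T α γ N ≤ C * FracSums.TStar α γ N) := by
  obtain ⟨C, hC, hupper⟩ := FracSums.exists_T_le hirr hL
  obtain ⟨c, hc, hlower⟩ := FracSums.exists_le_TStar hirr hL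
  obtain ⟨N₀, hN₀⟩ := Filter.eventually_atTop.1 (hupper.and hlower)
  -- The 1 serves `T* ≤ T`; the ratio `C / c` comes from chaining `T ≤ C N log N` with `c N log N ≤
  -- T*`.
  refine ⟨min c 1, max C (C / c), by positivity, by positivity, N₀, fun γ N hN => ?_⟩
  have hT := (hN₀ N hN).1 γ
  have hS := (hN₀ N hN).2 γ
  have hST := FracSums.TStar_le_T α γ N
  have hX : 0 ≤ (N : ℝ) * Real.log N := mul_nonneg (Nat.cast_nonneg N) (Real.log_natCast_nonneg N)
  have hS0 : 0 ≤ FracSums.TStar α γ N := (mul_nonneg hc.le hX).trans hS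
  have h1 : min c 1 * (N * Real.log N) ≤ FracSums.TStar α γ N :=
    (mul_le_mul_of_nonneg_right (min_le_left _ _) hX).trans hS
  have h2 : FracSums.T α γ N ≤ max C (C / c) * (N * Real.log N) :=
    hT.trans (mul_le_mul_of_nonneg_right (le_max_left _ _) hX)
  refine ⟨⟨h1.trans hST, h2⟩, ⟨h1, hST.trans h2⟩, ?_, ?_⟩
  · exact (mul_le_of_le_one_left hS0 (min_le_right _ _)).trans hST
  · calc FracSums.T α γ N ≤ C * (N * Real.log N) := hT
      _ = C / c * (c * (N * Real.log N)) := by field_simp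
      _ ≤ C / c * FracSums.TStar α γ N := by gcongr
      _ ≤ max C (C / c) * FracSums.TStar α γ N := by gcongr; exact le_max_right _ _
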